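/- **Setting.** Let $\mathbb{Z}((q,z))=\mathbb{Z}[[q,z]][q^{-1},z^{-1}]$. Let $\mathcal{A}=\mathbb{Z}((q,z))[S_{11}(\rho|\sigma):\rho,\sigma\in\mathbb{Z}^3]$ be the polynomial ring with one formal variable $S_{11}(\rho|\sigma)$ for each pair $\rho=(\rho_1,\rho_2,\rho_3)$, $\sigma=(\sigma_1,\sigma_2,\sigma_3)$ of integer vectors. Let $\delta_1,\delta_2,\delta_3$ be the standard basis of $\mathbb{Z}^3$, let $e_i\in\mathbb{Z}^3$ ($0\le i\le 3$) be the vector that starts with $i$ zeros followed by ones, and let $(a;q)_L=\prod_{j=0}^{L-1}(1-aq^j)$. **The ideal.** For $i\in\{1,2\}$ and $\rho,\sigma\in\mathbb{Z}^3$ define the following elements of $\mathcal{A}$: $$R_1^{(i)}(\rho|\sigma)=S_{11}(\rho|\sigma)-S_{11}(\rho+\delta_i-\delta_{i+1}|\sigma)-zq^{\,i+\sum_{j\le i}\rho_j}\,S_{11}\Big(\rho+2\sum_{j\le i}\delta_j\Big|\sigma-\sum_{j\le i}\delta_j\Big),$$ $$R_2^{(i)}(\rho|\sigma)=S_{11}(\rho|\sigma)-S_{11}(\rho|\sigma+\delta_i-\delta_{i+1})-q^{\,i+\sum_{j\le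 i}\sigma_j}\,S_{11}\Big(\rho-\sum_{j\le i}\delta_j\Big|\sigma+2\sum_{j\le i}\delta_j\Big);$$ if $\sigma_3=0$, $$R_3(\rho|\sigma)=S_{11}(\rho|\sigma)-S_{11}(\rho|\sigma+\delta_3)-qS_{11}(\rho+\delta_3|\sigma+\delta_3)+qS_{11}(\rho+\delta_3|\sigma+\delta_2+\delta_3);$$ and if $\rho_3=0$, $$R_4(\rho|\sigma)=S_{11}(\rho|\sigma)-S_{11}(\rho+\delta_3|\sigma)-qS_{11}(\rho+\delta_3|\sigma+\delta_3)+qS_{11}(\rho+\delta_2+\delta_3|\sigma+\delta_3).$$ For $N\in\mathbb{N}$ let $I_{11,N}\subset\mathcal{A}$ be the ideal generated by all of these elements for which all entries of $\rho$ and $\sigma$ lie in $[-N,N]$. **The coupled system.** A profile is a triple $c=(c_1,c_2,c_3)$ of non-negative integers with $c_1+c_2+c_3=8$. Let $I_c=\{i:c_i\neq0\}$, with indices taken modulo $3$. For $\emptyset\ne J\subseteq I_c$ let $c(J)$ be the profile with $c_i(J)=c_i-1$ if $i\in J$, $i-1\notin J$; $c_i(J)=c_i+1$ if $i\notin J$,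 $i-1\in J$; and $c_i(J)=c_i$ otherwise. The coupled $q$-difference relation of $c$, in the unknown functions $H_d(z,q)$ ($d$ a profile), is $$H_c(z,q)-\sum_{\emptyset\ne J\subseteq I_c}(-1)^{|J|-1}(zq;q)_{|J|-1}\,H_{c(J)}(zq^{|J|},q)=0 .$$ **The conjectured form.** Cyclic shifts of a profile give the same function $H$. Each profile has exactly one cyclic shift $(c_1,c_2,c_3)$ with $c_1\ge c_2$ and $c_1>c_3$, and for this shift $H_c(z,q)$ is written as $$\begin{cases}S_{11}((1,0,0)|(0,1,1))-q\,S_{11}((1,0,1)|(1,1,1))+qz\,S_{11}((2,1,1)|(0,0,0)),&c=(4,4,0),\\ S_{11}(e_{c_2}|e_0),&c_3=0,\ c\neq(4,4,0),\\ S_{11}(e_0|e_{c_3})-q(1-z)\,S_{11}(e_0+\delta_1|e_{c_3-1}),&c_2=0,\ c_3\ne0,\\ S_{11}(e_{c_2}|e_{c_3})-q\,S_{11}(e_{c_2-1}|e_{c_3-1}),&c_2,c_3>0.\end{cases}$$ The expression for $H_c(zq^n,q)$ is obtained by replacing $z$ by $zq^n$ in the coefficients and every $S_{11}(\rho|\sigma)$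 by $S_{11}(\rho+n\delta_1|\sigma)$. Let $\mathcal{S}_{11}\subset\mathcal{A}$ be the set of the left-hand sides of the coupled $q$-difference relations of all profiles after every $H_d(zq^n,q)$ has been replaced by its expression. **Theorem.** Every $h\in\mathcal{S}_{11}$ lies in $I_{11,6}$. -/

import Mathlib

/-! Formal Laurent series, the relations between the symbols `S(ρ | σ)` for modulus `11`,
and the coupled `q`-difference system for three-part profiles of size `8`. -/

noncomputable section

namespace Mod11

/-- The ring `ℤ((q, z))` of formal Laurent series in `q` and `z`: formal power series in the
two variables (`X 0` is `q`, `X 1` is `z`), with `q` and `z` made invertible. -/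
abbrev LaurentQZ : Type :=
  Localization.Away (MvPowerSeries.X 0 * MvPowerSeries.X 1 : MvPowerSeries (Fin 2) ℤ)

theorem isUnit_algebraMap_X (i : Fin 2) :
    IsUnit (algebraMap (MvPowerSeries (Fin 2) ℤ) LaurentQZ (MvPowerSeries.X i)) := by
  have h : IsUnit (algebraMap (MvPowerSeries (Fin 2) ℤ) LaurentQZ
      (MvPowerSeries.X 0 * MvPowerSeries.X 1)) :=
    IsLocalization.Away.algebraMap_isUnit _
  rw [map_mul] at h
  fin_cases i
  · exact isUnit_of_mul_isUnit_left h
  · exact isUnit_of_mul_isUnit_right h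

/-- The variable `q`, as a unit of `ℤ((q, z))`. -/
def qUnit : LaurentQZˣ := (isUnit_algebraMap_X 0).unit

/-- The power `q ^ n`, for an integer exponent `n`. -/
def qpow (n : ℤ) : LaurentQZ := ((qUnit ^ n : LaurentQZˣ) : LaurentQZ)

/-- The variable `z` of `ℤ((q, z))`. -/
def z : LaurentQZ := algebraMap (MvPowerSeries (Fin 2) ℤ) LaurentQZ (MvPowerSeries.X 1)

/-- The vectors `ρ` and `σ` are integer vectors with `3` entries, indexed from `0`: the usual
`ρ_j` and `δ_j` with `1 ≤ j ≤ 3` are `ρ (j - 1)` and `δ (j - 1)` here. -/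
abbrev Vec : Type := Fin 3 → ℤ

/-- The polynomial ring `ℤ((q, z))[S(ρ | σ)]` in one variable for each pair `(ρ, σ)`. -/
abbrev SRing : Type := MvPolynomial (Vec × Vec) LaurentQZ

/-- The variable `S(ρ | σ)`. -/
def S (ρ σ : Vec) : SRing := MvPolynomial.X (ρ, σ)

/-- An element of `ℤ((q, z))` as a constant polynomial. -/
def coef (a : LaurentQZ) : SRing := MvPolynomial.C a

/-- The standard basis vector `δ_j`. -/
def δ (j : Fin 3) : Vec := Pi.single j 1

/-- The partial sum `∑_{j ≤ i} δ_j`. -/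
def δsum (i : Fin 3) : Vec := ∑ j ∈ Finset.Iic i, δ j

/-- The left-hand side of the relation `R₁⁽ⁱ⁾(ρ | σ)`. The superscript takes the values `1, 2`;
it is `i + 1` here. -/
def R₁ (i : Fin 2) (ρ σ : Vec) : SRing :=
  S ρ σ - S (ρ + δ i.castSucc - δ i.succ) σ
    - coef (z * qpow (((i : ℕ) : ℤ) + 1 + ∑ j ∈ Finset.Iic i.castSucc, ρ j))
      * S (ρ + 2 • δsum i.castSucc) (σ - δsum i.castSucc)

/-- The left-hand side of the relation `R₂⁽ⁱ⁾(ρ | σ)`. The superscript is `i + 1` here. -/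
def R₂ (i : Fin 2) (ρ σ : Vec) : SRing :=
  S ρ σ - S ρ (σ + δ i.castSucc - δ i.succ)
    - coef (qpow (((i : ℕ) : ℤ) + 1 + ∑ j ∈ Finset.Iic i.castSucc, σ j))
      * S (ρ - δsum i.castSucc) (σ + 2 • δsum i.castSucc)

/-- The left-hand side of the relation `R₃(ρ | σ)`, a relation when the last entry of `σ`
is `0`. -/
def R₃ (ρ σ : Vec) : SRing :=
  S ρ σ - S ρ (σ + δ 2) - coef (qpow 1) * S (ρ + δ 2) (σ + δ 2)
    + coef (qpow 1) * S (ρ + δ 2) (σ + δ 1 + δ 2)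

/-- The left-hand side of the relation `R₄(ρ | σ)`, a relation when the last entry of `ρ`
is `0`. -/
def R₄ (ρ σ : Vec) : SRing :=
  S ρ σ - S (ρ + δ 2) σ - coef (qpow 1) * S (ρ + δ 2) (σ + δ 2)
    + coef (qpow 1) * S (ρ + δ 1 + δ 2) (σ + δ 2)

/-- All entries of `v` lie in `[-N, N]`. -/
def Bounded (N : ℕ) (v : Vec) : Prop := ∀ j, -(N : ℤ) ≤ v j ∧ v j ≤ (N : ℤ)

/-- The generators of `I_{11,N}`. -/
inductive IsGenerator (N : ℕ) : SRing → Prop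
  | r₁ (i : Fin 2) (ρ σ : Vec) (hρ : Bounded N ρ) (hσ : Bounded N σ) : IsGenerator N (R₁ i ρ σ)
  | r₂ (i : Fin 2) (ρ σ : Vec) (hρ : Bounded N ρ) (hσ : Bounded N σ) : IsGenerator N (R₂ i ρ σ)
  | r₃ (ρ σ : Vec) (hρ : Bounded N ρ) (hσ : Bounded N σ) (h : σ 2 = 0) : IsGenerator N (R₃ ρ σ)
  | r₄ (ρ σ : Vec) (hρ : Bounded N ρ) (hσ : Bounded N σ) (h : ρ 2 = 0) : IsGenerator N (R₄ ρ σ)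

/-- The ideal `I_{11,N}` of `ℤ((q, z))[S(ρ | σ)]`. -/
def I11 (N : ℕ) : Ideal SRing := Ideal.span {f | IsGenerator N f}

/-- Profiles with three parts; `c 0, c 1, c 2` are `c₁, c₂, c₃`. -/
abbrev Profile : Type := Fin 3 → ℕ

/-- The index set `I_c` of the non-zero entries of `c`. -/
def support (c : Profile) : Finset (Fin 3) := Finset.univ.filter fun i => c i ≠ 0

/-- The profile `c(J)`, for `J ⊆ I_c`. The index `i - 1` is cyclic. -/
def move (c : Profile) (J : Finset (Fin 3)) : Profile := fun i =>
  if i ∈ J ∧ i - 1 ∉ J then c i - 1 else if i ∉ J ∧ i - 1 ∈ J then c i + 1 else c i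

/-- The `q`-Pochhammer symbol `(zq; q)_L = (1 - zq)(1 - zq²) ⋯ (1 - zq^L)`. -/
def pochZQ (L : ℕ) : LaurentQZ := ∏ j ∈ Finset.range L, (1 - z * qpow ((j : ℤ) + 1))

/-- Formal linear combinations, over `ℤ((q, z))`, of the unknown functions `H_d(z qⁿ, q)`;
the pair `(d, n)` stands for `H_d(z qⁿ, q)`. -/
abbrev HModule : Type := (Profile × ℕ) →₀ LaurentQZ

/-- The coupled `q`-difference relation of the profile `c`, with all terms on the left-hand side:
`H_c(z, q) - ∑_{∅ ≠ J ⊆ I_c} (-1)^(|J|-1) (zq; q)_{|J|-1} H_{c(J)}(z q^|J|, q)`. -/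
def coupledRelation (c : Profile) : HModule :=
  Finsupp.single (c, 0) 1
    - ∑ J ∈ (support c).powerset.filter (fun J => J.Nonempty),
        Finsupp.single (move c J, J.card) ((-1) ^ (J.card - 1) * pochZQ (J.card - 1))

/-- The set of all coupled `q`-difference relations for profiles of size `8 = 11 - 3`. -/
def coupledSystem : Set HModule := {h | ∃ c : Profile, c 0 + c 1 + c 2 = 8 ∧ h = coupledRelation c}

/-- The cyclic shift `(c₁, c₂, c₃) ↦ (c₂, c₃, c₁)`. -/
def rotate (c : Profile) : Profile := fun i => c (i + 1)

/-- The representative of `c` up to cyclic shifts: the one with `c₁ ≥ c₂` and `c₁ > c₃`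
(there is exactly one such shift unless the three entries are equal). -/
def normalForm (c : Profile) : Profile :=
  if c 1 ≤ c 0 ∧ c 2 < c 0 then c
  else if rotate c 1 ≤ rotate c 0 ∧ rotate c 2 < rotate c 0 then rotate c
  else rotate (rotate c)

/-- The vector `e_i = (0, …, 0, 1, …, 1)` that starts with `i` zeros. -/
def e (i : ℕ) : Vec := fun j => if (j : ℕ) < i then 0 else 1

/-- `S(z qⁿ; ρ | σ)`, which is `S(z; ρ + n δ₁ | σ)`. -/
def Sshift (n : ℕ) (ρ σ : Vec) : SRing := S (ρ + n • δ 0) σ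

/-- The conjectural expression of `H_c(z qⁿ, q)` in the symbols `S(ρ | σ)`, for a profile `c` of
size `8`. The profile `(4, 4, 0)` is the only one up to cyclic shifts that the general formula
(the last three cases, valid for `c₂, c₃ ≤ 3`) does not cover. -/
def conjecturalForm (c : Profile) (n : ℕ) : SRing :=
  let d := normalForm c
  let zn : LaurentQZ := z * qpow n
  if d = ![4, 4, 0] then
    Sshift n ![1, 0, 0] ![0, 1, 1] - coef (qpow 1) * Sshift n ![1, 0, 1] ![1, 1, 1]
      + coef (qpow 1 * zn) * Sshift n ![2, 1, 1] ![0, 0, 0]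
  else if d 2 = 0 then
    Sshift n (e (d 1)) (e 0)
  else if d 1 = 0 then
    Sshift n (e 0) (e (d 2)) - coef (qpow 1 * (1 - zn)) * Sshift n (e 0 + δ 0) (e (d 2 - 1))
  else
    Sshift n (e (d 1)) (e (d 2)) - coef (qpow 1) * Sshift n (e (d 1 - 1)) (e (d 2 - 1))

/-- Replace every `H_d(z qⁿ, q)` by its conjectural expression. -/
def toSForm : HModule →ₗ[LaurentQZ] SRing :=
  Finsupp.linearCombination LaurentQZ fun p => conjecturalForm p.1 p.2

/-- The set of all relations of the coupled system, written in the conjectural form. -/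
def coupledSystemSForm : Set SRing := toSForm '' coupledSystem

end Mod11

end

noncomputable section

namespace Mod11

/-! Membership in the ideal is vanishing in the quotient ring, where each generator becomes a linear
rewriting rule among the classes `s`. Two reductions make the problem finite.

The relation of a profile and those of its cyclic shifts have the same image: shifting the profile
permutes the subsets `J`, and the expression for `H` depends only on the normal form
(`toSForm_coupledRelation_rotate`). As 3 does not divide 8, every orbit contains a genuine normal
form, which leaves 15 profiles.

For each of these, `residue_eq` writes the relation as at most eight terms, and an explicit
combination of the generators with coefficients in `ℤ[Z, Q]` accounts for it. The generators used
have all entries between -1 and 4, well inside the allowed box. For (8,0,0), (7,0,1), (6,0,2),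
(5,0,3) and (4,4,0) no generator is needed.

`R₃` and `R₄` at `(n, 0, 0 | 0, 0, 0)` have a meaning of their own: they say that the general
formula for `c₂, c₃ > 0` gives the same value on (3,3,2) and on its shifts (2,3,3) and (3,2,3),
respectively. -/

/-! ### Cyclic invariance of the coupled relations. -/

theorem rotate_three (c : Profile) : rotate (rotate (rotate c)) = c := by
  funext i
  fin_cases i <;> rfl

theorem normalForm_rotate (c : Profile) : normalForm (rotate c) = normalForm c := by
  have e0 : ∀ d : Profile, rotate d 0 = d 1 := fun _ => rfl
  have e1 : ∀ d : Profile, rotate d 1 = d 2 := fun _ => rfl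
  have e2 : ∀ d : Profile, rotate d 2 = d 0 := fun _ => rfl
  unfold normalForm
  simp only [rotate_three, e0, e1, e2]
  split_ifs <;> first | rfl | omega | skip
  -- The branch that remains is the one where no shift passes the test; then the three entries are
  -- equal and rotation does nothing.
  funext i
  fin_cases i <;> simp [rotate] <;> omega

theorem conjecturalForm_eq_of_normalForm_eq {c d : Profile} (h : normalForm c = normalForm d)
    (n : ℕ) : conjecturalForm c n = conjecturalForm d n := by
  unfold conjecturalForm
  rw [h]

theorem conjecturalForm_rotate (c : Profile) (n : ℕ) :
    conjecturalForm (rotate c) n = conjecturalForm c n :=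
  conjecturalForm_eq_of_normalForm_eq (normalForm_rotate c) n

/-- The coupled relation of `c` in the conjectural form, as a sum over all subsets of the three
indices. -/
theorem toSForm_coupledRelation (c : Profile) :
    toSForm (coupledRelation c) = conjecturalForm c 0
      - ∑ J : Finset (Fin 3), if J ⊆ support c ∧ J.Nonempty then
          coef ((-1) ^ (J.card - 1) * pochZQ (J.card - 1)) * conjecturalForm (move c J) J.card
        else 0 := by
  have hset : (support c).powerset.filter (fun J => J.Nonempty)
      = Finset.univ.filter fun J => J ⊆ support c ∧ J.Nonempty := by
    ext J
    simp
  rw [coupledRelation, hset, map_sub, map_sum, ← Finset.sum_filter]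
  simp only [toSForm, Finsupp.linearCombination_single, one_smul, coef, MvPolynomial.smul_eq_C_mul]

/-- The rule for `move` compares only `i` with `i - 1`, so it commutes with translating all indices.
-/
theorem move_map_add_one (c : Profile) (J : Finset (Fin 3)) :
    rotate (move c (J.map (Equiv.addRight 1).toEmbedding)) = move (rotate c) J := by
  have h : ∀ i : Fin 3, i ∈ J.map (Equiv.addRight 1).toEmbedding ↔ i - 1 ∈ J := by
    intro i
    simp [Finset.mem_map_equiv, sub_eq_add_neg]
  funext i
  simp only [rotate, move, h, add_sub_cancel_right]

theorem mem_support (c : Profile) (i : Fin 3) : i ∈ support c ↔ c i ≠ 0 := by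
  simp [support]

theorem map_add_one_subset_support (c : Profile) (J : Finset (Fin 3)) :
    J.map (Equiv.addRight 1).toEmbedding ⊆ support c ↔ J ⊆ support (rotate c) := by
  rw [Finset.map_eq_image, Finset.image_subset_iff]
  simp only [Finset.subset_iff, mem_support, rotate, Equiv.coe_toEmbedding, Equiv.coe_addRight]

theorem toSForm_coupledRelation_rotate (c : Profile) :
    toSForm (coupledRelation (rotate c)) = toSForm (coupledRelation c) := by
  rw [toSForm_coupledRelation, toSForm_coupledRelation, conjecturalForm_rotate]
  congr 1
  -- Reindex by `J ↦ J + 1`, which preserves cardinality and hence the coefficients and the powers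
  -- of `q` in the arguments.
  refine Fintype.sum_equiv (Equiv.finsetCongr (Equiv.addRight (1 : Fin 3))) _ _ fun J => ?_
  simp only [Equiv.finsetCongr_apply, Finset.card_map, Finset.map_nonempty,
    map_add_one_subset_support, ← move_map_add_one, conjecturalForm_rotate]

theorem toSForm_coupledRelation_normalForm (c : Profile) :
    toSForm (coupledRelation (normalForm c)) = toSForm (coupledRelation c) := by
  unfold normalForm
  split_ifs <;> simp only [toSForm_coupledRelation_rotate]

/-- The size 8 excludes three equal entries, so the fallback branch of `normalForm` also satisfies
the inequalities. -/
theorem normalForm_spec {c : Profile} (h : c 0 + c 1 + c 2 = 8) :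
    ∃ a b d : ℕ, normalForm c = ![a, b, d] ∧ a + b + d = 8 ∧ b ≤ a ∧ d < a := by
  have e0 : ∀ d : Profile, rotate d 0 = d 1 := fun _ => rfl
  have e1 : ∀ d : Profile, rotate d 1 = d 2 := fun _ => rfl
  have e2 : ∀ d : Profile, rotate d 2 = d 0 := fun _ => rfl
  refine ⟨normalForm c 0, normalForm c 1, normalForm c 2, ?_, ?_⟩
  · funext i
    fin_cases i <;> rfl
  · unfold normalForm
    split_ifs <;> simp only [e0, e1, e2] at * <;> omega

/-! ### The quotient ring and the generators as identities in it. -/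

/-- The ring `ℤ((q, z))[S(ρ | σ)]` modulo the relations with entries in `[-6, 6]`. -/
abbrev RelationQuotient : Type := SRing ⧸ I11 6

/-- The quotient map. -/
def cls : SRing →+* RelationQuotient := Ideal.Quotient.mk (I11 6)

/-- The class of `S(a, b, c | d, e, f)`. -/
def s (a b c d e f : ℤ) : RelationQuotient := cls (S ![a, b, c] ![d, e, f])

/-- The class of `q`. -/
def Q : RelationQuotient := cls (coef (qpow 1))

/-- The class of `z`. -/
def Z : RelationQuotient := cls (coef z)

theorem coef_mul (a b : LaurentQZ) : coef (a * b) = coef a * coef b := map_mul MvPolynomial.C a b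

theorem coef_sub (a b : LaurentQZ) : coef (a - b) = coef a - coef b := map_sub MvPolynomial.C a b

theorem coef_neg (a : LaurentQZ) : coef (-a) = -coef a := map_neg MvPolynomial.C a

theorem coef_one : coef 1 = 1 := map_one MvPolynomial.C

theorem cls_coef_qpow (n : ℕ) : cls (coef (qpow n)) = Q ^ n := by
  have h : qpow n = qpow 1 ^ n := by
    simp [qpow]
  rw [h, Q, ← map_pow]
  exact congrArg cls (map_pow MvPolynomial.C _ _)

theorem cls_eq_zero_of_isGenerator {f : SRing} (h : IsGenerator 6 f) : cls f = 0 :=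
  Ideal.Quotient.eq_zero_iff_mem.mpr (Ideal.subset_span h)

instance (N : ℕ) (v : Vec) : Decidable (Bounded N v) :=
  inferInstanceAs (Decidable (∀ j, -(N : ℤ) ≤ v j ∧ v j ≤ (N : ℤ)))

theorem δsum_zero : δsum 0 = ![1, 0, 0] := by
  decide +kernel

theorem δsum_one : δsum 1 = ![1, 1, 0] := by
  decide +kernel

theorem δ_eq : δ 0 = ![1, 0, 0] ∧ δ 1 = ![0, 1, 0] ∧ δ 2 = ![0, 0, 1] := by
  decide +kernel

theorem sum_Iic_zero (v : Vec) : ∑ j ∈ Finset.Iic (0 : Fin 3), v j = v 0 := by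
  rw [show Finset.Iic (0 : Fin 3) = {0} by decide, Finset.sum_singleton]

theorem sum_Iic_one (v : Vec) : ∑ j ∈ Finset.Iic (1 : Fin 3), v j = v 0 + v 1 := by
  rw [show Finset.Iic (1 : Fin 3) = {0, 1} by decide, Finset.sum_pair (by decide)]

section Relations

variable (a b c d e f : ℤ)

/-- The exponent of `q` is passed as a natural number `n`, so that only ordinary powers of `Q` occur
and `ring1` can handle them; on numerals the side conditions are discharged by the default `decide`.
-/
theorem relation_r₁_one (n : ℕ) (hρ : Bounded 6 ![a, b, c] := by decide)
    (hσ : Bounded 6 ![d, e, f] := by decide) (hn : (n : ℤ) = 1 + a := by decide) :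
    s a b c d e f - s (a + 1) (b - 1) c d e f - Z * Q ^ n * s (a + 2) b c (d - 1) e f = 0 := by
  rw [← cls_eq_zero_of_isGenerator (.r₁ 0 ![a, b, c] ![d, e, f] hρ hσ), R₁, ← cls_coef_qpow]
  simp [s, Z, hn, coef_mul, δsum_zero, δ_eq, sum_Iic_zero]

theorem relation_r₁_two (n : ℕ) (hρ : Bounded 6 ![a, b, c] := by decide)
    (hσ : Bounded 6 ![d, e, f] := by decide) (hn : (n : ℤ) = 2 + (a + b) := by decide) :
    s a b c d e f - s a (b + 1) (c - 1) d e f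
      - Z * Q ^ n * s (a + 2) (b + 2) c (d - 1) (e - 1) f = 0 := by
  rw [← cls_eq_zero_of_isGenerator (.r₁ 1 ![a, b, c] ![d, e, f] hρ hσ), R₁, ← cls_coef_qpow]
  simp [s, Z, hn, coef_mul, δsum_one, δ_eq, sum_Iic_one, ← one_add_one_eq_two]

theorem relation_r₂_one (n : ℕ) (hρ : Bounded 6 ![a, b, c] := by decide)
    (hσ : Bounded 6 ![d, e, f] := by decide) (hn : (n : ℤ) = 1 + d := by decide) :
    s a b c d e f - s a b c (d + 1) (e - 1) f - Q ^ n * s (a - 1) b c (d + 2) e f = 0 := by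
  rw [← cls_eq_zero_of_isGenerator (.r₂ 0 ![a, b, c] ![d, e, f] hρ hσ), R₂, ← cls_coef_qpow]
  simp [s, hn, δsum_zero, δ_eq, sum_Iic_zero]

theorem relation_r₂_two (n : ℕ) (hρ : Bounded 6 ![a, b, c] := by decide)
    (hσ : Bounded 6 ![d, e, f] := by decide) (hn : (n : ℤ) = 2 + (d + e) := by decide) :
    s a b c d e f - s a b c d (e + 1) (f - 1)
      - Q ^ n * s (a - 1) (b - 1) c (d + 2) (e + 2) f = 0 := by
  rw [← cls_eq_zero_of_isGenerator (.r₂ 1 ![a, b, c] ![d, e, f] hρ hσ), R₂, ← cls_coef_qpow]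
  simp [s, hn, δsum_one, δ_eq, sum_Iic_one, ← one_add_one_eq_two]

theorem relation_r₃ (hρ : Bounded 6 ![a, b, c] := by decide)
    (hσ : Bounded 6 ![d, e, 0] := by decide) :
    s a b c d e 0 - s a b c d e 1 - Q * s a b (c + 1) d e 1
      + Q * s a b (c + 1) d (e + 1) 1 = 0 := by
  rw [← cls_eq_zero_of_isGenerator (.r₃ ![a, b, c] ![d, e, 0] hρ hσ rfl), R₃]
  simp [s, Q, δ_eq]

theorem relation_r₄ (hρ : Bounded 6 ![a, b, 0] := by decide)
    (hσ : Bounded 6 ![d, e, f] := by decide) :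
    s a b 0 d e f - s a b 1 d e f - Q * s a b 1 d e (f + 1)
      + Q * s a (b + 1) 1 d e (f + 1) = 0 := by
  rw [← cls_eq_zero_of_isGenerator (.r₄ ![a, b, 0] ![d, e, f] hρ hσ rfl), R₄]
  simp [s, Q, δ_eq]

end Relations

/-! ### The expressions for `H`, one for each normal form. -/

/-- The class of the conjectural expression of `H_c(z qⁿ, q)`. -/
def form (c : Profile) (n : ℕ) : RelationQuotient := cls (conjecturalForm c n)

theorem cls_Sshift (a b c d e f : ℤ) (n : ℕ) :
    cls (Sshift n ![a, b, c] ![d, e, f]) = s (n + a) b c d e f := by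
  simp [Sshift, s, δ_eq, add_comm]

theorem e_eq : e 0 = ![1, 1, 1] ∧ e 1 = ![0, 1, 1] ∧ e 2 = ![0, 0, 1] ∧ e 3 = ![0, 0, 0] := by
  decide

theorem e_zero_add : e 0 + δ 0 = ![2, 1, 1] := by
  decide

variable {c : Profile}

theorem form_of_third_eq_zero {a b : ℕ} (h : normalForm c = ![a, b, 0]) (hb : b ≠ 4) (n : ℕ) :
    form c n = cls (Sshift n (e b) (e 0)) := by
  -- The second entry alone rules out the exceptional profile.
  have h' : ![a, b, 0] ≠ ![4, 4, 0] := fun H => hb (congrFun H 1)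
  simp [form, conjecturalForm, h, h']

theorem form_of_second_eq_zero {a d : ℕ} (h : normalForm c = ![a, 0, d + 1]) (n : ℕ) :
    form c n = cls (Sshift n (e 0) (e (d + 1)))
      - Q * (1 - Z * Q ^ n) * cls (Sshift n ![2, 1, 1] (e d)) := by
  simp [form, conjecturalForm, h, e_zero_add, Q, Z, coef_mul, coef_sub, coef_one, cls_coef_qpow]

theorem form_of_pos {a b d : ℕ} (h : normalForm c = ![a, b + 1, d + 1]) (n : ℕ) :
    form c n = cls (Sshift n (e (b + 1)) (e (d + 1))) - Q * cls (Sshift n (e b) (e d)) := by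
  simp [form, conjecturalForm, h, Q]

theorem form_four_four_zero (h : normalForm c = ![4, 4, 0]) (n : ℕ) :
    form c n = s (n + 1) 0 0 0 1 1 - Q * s (n + 1) 0 1 1 1 1
      + Z * Q ^ (n + 1) * s (n + 2) 1 1 0 0 0 := by
  simp only [form, conjecturalForm, h, if_true, map_add, map_sub, map_mul, cls_Sshift, coef_mul,
    cls_coef_qpow, Q, Z]
  ring

theorem form_eight_zero_zero (h : normalForm c = ![8, 0, 0]) (n : ℕ) :
    form c n = s (n + 1) 1 1 1 1 1 := by
  simp [form_of_third_eq_zero h (by decide), e_eq, cls_Sshift]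

theorem form_seven_one_zero (h : normalForm c = ![7, 1, 0]) (n : ℕ) :
    form c n = s n 1 1 1 1 1 := by
  simp [form_of_third_eq_zero h (by decide), e_eq, cls_Sshift]

theorem form_seven_zero_one (h : normalForm c = ![7, 0, 1]) (n : ℕ) :
    form c n = s (n + 1) 1 1 0 1 1 - Q * (1 - Z * Q ^ n) * s (n + 2) 1 1 1 1 1 := by
  simp [form_of_second_eq_zero h, e_eq, cls_Sshift]

theorem form_six_two_zero (h : normalForm c = ![6, 2, 0]) (n : ℕ) :
    form c n = s n 0 1 1 1 1 := by
  simp [form_of_third_eq_zero h (by decide), e_eq, cls_Sshift]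

theorem form_six_one_one (h : normalForm c = ![6, 1, 1]) (n : ℕ) :
    form c n = s n 1 1 0 1 1 - Q * s (n + 1) 1 1 1 1 1 := by
  simp [form_of_pos h, e_eq, cls_Sshift]

theorem form_six_zero_two (h : normalForm c = ![6, 0, 2]) (n : ℕ) :
    form c n = s (n + 1) 1 1 0 0 1 - Q * (1 - Z * Q ^ n) * s (n + 2) 1 1 0 1 1 := by
  simp [form_of_second_eq_zero h, e_eq, cls_Sshift]

theorem form_five_three_zero (h : normalForm c = ![5, 3, 0]) (n : ℕ) :
    form c n = s n 0 0 1 1 1 := by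
  simp [form_of_third_eq_zero h (by decide), e_eq, cls_Sshift]

theorem form_five_two_one (h : normalForm c = ![5, 2, 1]) (n : ℕ) :
    form c n = s n 0 1 0 1 1 - Q * s n 1 1 1 1 1 := by
  simp [form_of_pos h, e_eq, cls_Sshift]

theorem form_five_one_two (h : normalForm c = ![5, 1, 2]) (n : ℕ) :
    form c n = s n 1 1 0 0 1 - Q * s (n + 1) 1 1 0 1 1 := by
  simp [form_of_pos h, e_eq, cls_Sshift]

theorem form_five_zero_three (h : normalForm c = ![5, 0, 3]) (n : ℕ) :
    form c n = s (n + 1) 1 1 0 0 0 - Q * (1 - Z * Q ^ n) * s (n + 2) 1 1 0 0 1 := by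
  simp [form_of_second_eq_zero h, e_eq, cls_Sshift]

theorem form_four_three_one (h : normalForm c = ![4, 3, 1]) (n : ℕ) :
    form c n = s n 0 0 0 1 1 - Q * s n 0 1 1 1 1 := by
  simp [form_of_pos h, e_eq, cls_Sshift]

theorem form_four_two_two (h : normalForm c = ![4, 2, 2]) (n : ℕ) :
    form c n = s n 0 1 0 0 1 - Q * s n 1 1 0 1 1 := by
  simp [form_of_pos h, e_eq, cls_Sshift]

theorem form_four_one_three (h : normalForm c = ![4, 1, 3]) (n : ℕ) :
    form c n = s n 1 1 0 0 0 - Q * s (n + 1) 1 1 0 0 1 := by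
  simp [form_of_pos h, e_eq, cls_Sshift]

theorem form_three_three_two (h : normalForm c = ![3, 3, 2]) (n : ℕ) :
    form c n = s n 0 0 0 0 1 - Q * s n 0 1 0 1 1 := by
  simp [form_of_pos h, e_eq, cls_Sshift]

/-! ### The coupled relation expanded over subsets of the indices. -/

theorem univ_finset_fin_three : (Finset.univ : Finset (Finset (Fin 3)))
    = {∅, {0}, {1}, {2}, {0, 1}, {0, 2}, {1, 2}, {0, 1, 2}} := by
  decide

/-- The coupled relation of `c` in the conjectural form, modulo the relations. -/
def residue (c : Profile) : RelationQuotient := cls (toSForm (coupledRelation c))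

/-- One term for each nonempty `J`, guarded by `J ⊆ I_c`. The outer minus sign meets `(-1) ^ (|J| -
1)`, so exactly the two-element subsets enter with a plus. -/
theorem residue_eq (c : Profile) :
    residue c = form c 0
      - (if c 0 ≠ 0 then form (move c {0}) 1 else 0)
      - (if c 1 ≠ 0 then form (move c {1}) 1 else 0)
      - (if c 2 ≠ 0 then form (move c {2}) 1 else 0)
      + (if c 0 ≠ 0 ∧ c 1 ≠ 0 then (1 - Z * Q) * form (move c {0, 1}) 2 else 0)
      + (if c 0 ≠ 0 ∧ c 2 ≠ 0 then (1 - Z * Q) * form (move c {0, 2}) 2 else 0)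
      + (if c 1 ≠ 0 ∧ c 2 ≠ 0 then (1 - Z * Q) * form (move c {1, 2}) 2 else 0)
      - (if c 0 ≠ 0 ∧ c 1 ≠ 0 ∧ c 2 ≠ 0 then
          (1 - Z * Q) * (1 - Z * Q ^ 2) * form (move c {0, 1, 2}) 3 else 0) := by
  have hp : ∀ i : ℕ, cls (coef (1 - z * qpow ((i : ℤ) + 1))) = 1 - Z * Q ^ (i + 1) := by
    intro i
    rw [← cls_coef_qpow]
    simp [coef_sub, coef_one, coef_mul, Z]
  have h0 : cls (coef (pochZQ 0)) = 1 := by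
    simp [pochZQ, coef_one]
  have h1 : cls (coef (pochZQ 1)) = 1 - Z * Q := by
    rw [pochZQ, Finset.prod_range_one, hp, zero_add, pow_one]
  have h2 : cls (coef (pochZQ 2)) = (1 - Z * Q) * (1 - Z * Q ^ 2) := by
    rw [pochZQ, Finset.prod_range_succ, Finset.prod_range_one, coef_mul, map_mul, hp, hp, zero_add,
      pow_one]
  have hi : ∀ (p : Prop) [Decidable p] (x : SRing),
      cls (if p then x else 0) = if p then cls x else 0 := by
    intro p _ x
    split_ifs <;> simp
  rw [residue, toSForm_coupledRelation, univ_finset_fin_three]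
  repeat rw [Finset.sum_insert (by decide)]
  rw [Finset.sum_singleton]
  have c2 : ∀ i j : Fin 3, i ≠ j → ({i, j} : Finset (Fin 3)).card = 2 := fun _ _ => Finset.card_pair
  have c3 : ({0, 1, 2} : Finset (Fin 3)).card = 3 := by decide
  simp only [map_sub, map_add, hi, map_mul, coef_mul, c3, c2 0 1 (by decide), c2 0 2 (by decide),
    c2 1 2 (by decide), Finset.card_singleton, Finset.insert_subset_iff, Finset.singleton_subset_iff,
    mem_support, Finset.singleton_nonempty, Finset.insert_nonempty, Finset.not_nonempty_empty,
    and_true, and_false, if_false, Nat.sub_self, Nat.reduceSub, pow_zero, pow_one, neg_one_sq,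
    coef_neg, coef_one, map_neg, map_one, map_zero, h0, h1, h2, form]
  by_cases k0 : c 0 = 0 <;> by_cases k1 : c 1 = 0 <;> by_cases k2 : c 2 = 0 <;>
    simp only [k0, k1, k2, ne_eq, not_true_eq_false, not_false_eq_true, and_true, and_false,
      if_true, if_false] <;> ring1

/-! ### Certificates for the 15 normal forms. -/

set_option linter.unusedSimpArgs false

theorem residue_eight_zero_zero : residue ![8, 0, 0] = 0 := by
  rw [residue_eq]
  simp only [Matrix.cons_val, ne_eq, OfNat.ofNat_ne_zero, one_ne_zero, not_true_eq_false,
    not_false_eq_true, and_true, and_false, and_self, false_and, if_true, if_false,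
    form_eight_zero_zero (c := ![8, 0, 0]) (by decide),
    form_seven_one_zero (c := move ![8, 0, 0] {0}) (by decide)]
  simp only [Nat.cast_zero, Nat.cast_one, Nat.cast_ofNat, Int.reduceAdd, zero_add]
  ring1

/-- The (7,0,1) and (6,1,1) terms combine to `-zq S(2,1,1 | 0,1,1)`, which makes the whole relation
a single `R₁⁽¹⁾`. -/
theorem residue_seven_one_zero : residue ![7, 1, 0] = 0 := by
  rw [residue_eq]
  simp only [Matrix.cons_val, ne_eq, OfNat.ofNat_ne_zero, one_ne_zero, not_true_eq_false,
    not_false_eq_true, and_true, and_false, and_self, false_and, if_true, if_false,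
    form_seven_one_zero (c := ![7, 1, 0]) (by decide),
    form_six_two_zero (c := move ![7, 1, 0] {0}) (by decide),
    form_seven_zero_one (c := move ![7, 1, 0] {1}) (by decide),
    form_six_one_one (c := move ![7, 1, 0] {0, 1}) (by decide)]
  -- The integer arguments of `s` have to be evaluated first, so that `ring1` recognises equal
  -- symbols as the same atom.
  linear_combination (norm := (simp only [Nat.cast_zero, Nat.cast_one, Nat.cast_ofNat,
    Int.reduceAdd, Int.reduceSub, Int.reduceNeg, zero_add, add_zero, sub_zero]; ring1))
    relation_r₁_one 0 1 1 1 1 1 1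

theorem residue_seven_zero_one : residue ![7, 0, 1] = 0 := by
  rw [residue_eq]
  simp only [Matrix.cons_val, ne_eq, OfNat.ofNat_ne_zero, one_ne_zero, not_true_eq_false,
    not_false_eq_true, and_true, and_false, and_self, false_and, if_true, if_false,
    form_seven_zero_one (c := ![7, 0, 1]) (by decide),
    form_six_one_one (c := move ![7, 0, 1] {0}) (by decide),
    form_eight_zero_zero (c := move ![7, 0, 1] {2}) (by decide),
    form_seven_one_zero (c := move ![7, 0, 1] {0, 2}) (by decide)]
  simp only [Nat.cast_zero, Nat.cast_one, Nat.cast_ofNat, Int.reduceAdd, zero_add]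
  ring1

theorem residue_six_two_zero : residue ![6, 2, 0] = 0 := by
  rw [residue_eq]
  simp only [Matrix.cons_val, ne_eq, OfNat.ofNat_ne_zero, one_ne_zero, not_true_eq_false,
    not_false_eq_true, and_true, and_false, and_self, false_and, if_true, if_false,
    form_six_two_zero (c := ![6, 2, 0]) (by decide),
    form_five_three_zero (c := move ![6, 2, 0] {0}) (by decide),
    form_six_one_one (c := move ![6, 2, 0] {1}) (by decide),
    form_five_two_one (c := move ![6, 2, 0] {0, 1}) (by decide)]
  linear_combination (norm := (simp only [Nat.cast_zero, Nat.cast_one, Nat.cast_ofNat,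
    Int.reduceAdd, Int.reduceSub, Int.reduceNeg, zero_add, add_zero, sub_zero]; ring1))
    relation_r₁_one 0 0 1 1 1 1 1
    + relation_r₁_two 1 (-1) 1 1 1 1 2
    - relation_r₁_one 1 1 1 0 1 1 2
    -- Here `1 + σ₁ = 0`. This cancels the symbols at `(3,1,1 | -1,1,1)` and `(3,1,1 | 0,0,1)` left
    -- by the two preceding relations and produces the needed one at `(2,1,1 | 1,1,1)`.
    - Z * Q ^ 2 * relation_r₂_one 3 1 1 (-1) 1 1 0

theorem residue_six_one_one : residue ![6, 1, 1] = 0 := by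
  rw [residue_eq]
  simp only [Matrix.cons_val, ne_eq, OfNat.ofNat_ne_zero, one_ne_zero, not_true_eq_false,
    not_false_eq_true, and_true, and_false, and_self, false_and, if_true, if_false,
    form_six_one_one (c := ![6, 1, 1]) (by decide),
    form_five_two_one (c := move ![6, 1, 1] {0}) (by decide),
    form_six_zero_two (c := move ![6, 1, 1] {1}) (by decide),
    form_seven_one_zero (c := move ![6, 1, 1] {2}) (by decide),
    form_five_one_two (c := move ![6, 1, 1] {0, 1}) (by decide),
    form_six_two_zero (c := move ![6, 1, 1] {0, 2}) (by decide),
    form_seven_zero_one (c := move ![6, 1, 1] {1, 2}) (by decide),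
    form_six_one_one (c := move ![6, 1, 1] {0, 1, 2}) (by decide)]
  linear_combination (norm := (simp only [Nat.cast_zero, Nat.cast_one, Nat.cast_ofNat,
    Int.reduceAdd, Int.reduceSub, Int.reduceNeg, zero_add, add_zero, sub_zero]; ring1))
    relation_r₁_one 0 1 1 0 1 1 1
    + Z * Q * relation_r₂_one 2 1 1 (-1) 1 1 0
    - (1 - Z * Q) * relation_r₁_one 1 1 1 1 1 1 2

theorem residue_six_zero_two : residue ![6, 0, 2] = 0 := by
  rw [residue_eq]
  simp only [Matrix.cons_val, ne_eq, OfNat.ofNat_ne_zero, one_ne_zero, not_true_eq_false,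
    not_false_eq_true, and_true, and_false, and_self, false_and, if_true, if_false,
    form_six_zero_two (c := ![6, 0, 2]) (by decide),
    form_five_one_two (c := move ![6, 0, 2] {0}) (by decide),
    form_seven_zero_one (c := move ![6, 0, 2] {2}) (by decide),
    form_six_one_one (c := move ![6, 0, 2] {0, 2}) (by decide)]
  simp only [Nat.cast_zero, Nat.cast_one, Nat.cast_ofNat, Int.reduceAdd, zero_add]
  ring1

theorem residue_five_three_zero : residue ![5, 3, 0] = 0 := by
  rw [residue_eq]
  simp only [Matrix.cons_val, ne_eq, OfNat.ofNat_ne_zero, one_ne_zero, not_true_eq_false,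
    not_false_eq_true, and_true, and_false, and_self, false_and, if_true, if_false,
    form_five_three_zero (c := ![5, 3, 0]) (by decide),
    form_four_four_zero (c := move ![5, 3, 0] {0}) (by decide),
    form_five_two_one (c := move ![5, 3, 0] {1}) (by decide),
    form_four_three_one (c := move ![5, 3, 0] {0, 1}) (by decide)]
  linear_combination (norm := (simp only [Nat.cast_zero, Nat.cast_one, Nat.cast_ofNat,
    Int.reduceAdd, Int.reduceSub, Int.reduceNeg, zero_add, add_zero, sub_zero]; ring1))
    relation_r₄ 1 (-1) 1 1 0
    + relation_r₁_two 1 (-1) 1 1 1 0 2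
    + relation_r₄ 1 0 1 1 0
    + relation_r₁_one 0 0 0 1 1 1 1
    + Q * relation_r₂_one 1 (-1) 1 1 2 1 2
    - Q * relation_r₁_one 0 0 1 2 1 1 1
    - relation_r₂_two 1 0 1 1 0 1 3
    - relation_r₂_one 1 0 1 0 1 1 1
    - relation_r₃ 1 (-1) 0 1 1

theorem residue_five_two_one : residue ![5, 2, 1] = 0 := by
  rw [residue_eq]
  simp only [Matrix.cons_val, ne_eq, OfNat.ofNat_ne_zero, one_ne_zero, not_true_eq_false,
    not_false_eq_true, and_true, and_false, and_self, false_and, if_true, if_false,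
    form_five_two_one (c := ![5, 2, 1]) (by decide),
    form_four_three_one (c := move ![5, 2, 1] {0}) (by decide),
    form_five_one_two (c := move ![5, 2, 1] {1}) (by decide),
    form_six_two_zero (c := move ![5, 2, 1] {2}) (by decide),
    form_four_two_two (c := move ![5, 2, 1] {0, 1}) (by decide),
    form_five_three_zero (c := move ![5, 2, 1] {0, 2}) (by decide),
    form_six_one_one (c := move ![5, 2, 1] {1, 2}) (by decide),
    form_five_two_one (c := move ![5, 2, 1] {0, 1, 2}) (by decide)]
  linear_combination (norm := (simp only [Nat.cast_zero, Nat.cast_one, Nat.cast_ofNat,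
    Int.reduceAdd, Int.reduceSub, Int.reduceNeg, zero_add, add_zero, sub_zero]; ring1))
    relation_r₁_one 0 0 1 0 1 1 1
    + relation_r₁_two 1 (-1) 1 0 1 1 2
    + Z * Q * relation_r₂_one 2 0 1 (-1) 1 1 0
    + (Z * Q ^ 3 - Z ^ 2 * Q ^ 4) * relation_r₂_one 4 1 1 (-1) 1 1 0
    + (1 - Z * Q) * relation_r₁_one 2 1 1 0 1 1 3
    - (1 - Z * Q) * relation_r₁_one 1 0 1 1 1 1 2
    - (1 - Z * Q) * relation_r₁_two 2 (-1) 1 1 1 1 3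
    - relation_r₁_one 1 1 1 0 0 1 2
    - Q * relation_r₁_one 0 1 1 1 1 1 1

theorem residue_five_one_two : residue ![5, 1, 2] = 0 := by
  rw [residue_eq]
  simp only [Matrix.cons_val, ne_eq, OfNat.ofNat_ne_zero, one_ne_zero, not_true_eq_false,
    not_false_eq_true, and_true, and_false, and_self, false_and, if_true, if_false,
    form_five_one_two (c := ![5, 1, 2]) (by decide),
    form_four_two_two (c := move ![5, 1, 2] {0}) (by decide),
    form_five_zero_three (c := move ![5, 1, 2] {1}) (by decide),
    form_six_one_one (c := move ![5, 1, 2] {2}) (by decide),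
    form_four_one_three (c := move ![5, 1, 2] {0, 1}) (by decide),
    form_five_two_one (c := move ![5, 1, 2] {0, 2}) (by decide),
    form_six_zero_two (c := move ![5, 1, 2] {1, 2}) (by decide),
    form_five_one_two (c := move ![5, 1, 2] {0, 1, 2}) (by decide)]
  linear_combination (norm := (simp only [Nat.cast_zero, Nat.cast_one, Nat.cast_ofNat,
    Int.reduceAdd, Int.reduceSub, Int.reduceNeg, zero_add, add_zero, sub_zero]; ring1))
    Z * Q * relation_r₂_one 2 1 1 (-1) 0 1 0
    + Z * Q * relation_r₂_two 2 1 1 0 (-1) 1 1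
    + relation_r₁_one 0 1 1 0 0 1 1
    - Z * Q ^ 2 * relation_r₁_one 0 1 1 2 1 1 1
    - Z * Q * relation_r₂_one 1 1 1 0 1 1 1
    - (1 - Z * Q) * relation_r₁_one 1 1 1 0 1 1 2
    - (Z * Q ^ 2 - Z ^ 2 * Q ^ 3) * relation_r₂_one 3 1 1 (-1) 1 1 0

theorem residue_five_zero_three : residue ![5, 0, 3] = 0 := by
  rw [residue_eq]
  simp only [Matrix.cons_val, ne_eq, OfNat.ofNat_ne_zero, one_ne_zero, not_true_eq_false,
    not_false_eq_true, and_true, and_false, and_self, false_and, if_true, if_false,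
    form_five_zero_three (c := ![5, 0, 3]) (by decide),
    form_four_one_three (c := move ![5, 0, 3] {0}) (by decide),
    form_six_zero_two (c := move ![5, 0, 3] {2}) (by decide),
    form_five_one_two (c := move ![5, 0, 3] {0, 2}) (by decide)]
  simp only [Nat.cast_zero, Nat.cast_one, Nat.cast_ofNat, Int.reduceAdd, zero_add]
  ring1

/-- The exceptional expression is exactly what this relation gives when solved for `H` of (4,4,0),
so the terms cancel identically. -/
theorem residue_four_four_zero : residue ![4, 4, 0] = 0 := by
  rw [residue_eq]
  simp only [Matrix.cons_val, ne_eq, OfNat.ofNat_ne_zero, one_ne_zero, not_true_eq_false,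
    not_false_eq_true, and_true, and_false, and_self, false_and, if_true, if_false,
    form_four_four_zero (c := ![4, 4, 0]) (by decide),
    form_five_zero_three (c := move ![4, 4, 0] {0}) (by decide),
    form_four_three_one (c := move ![4, 4, 0] {1}) (by decide),
    form_four_one_three (c := move ![4, 4, 0] {0, 1}) (by decide)]
  simp only [Nat.cast_zero, Nat.cast_one, Nat.cast_ofNat, Int.reduceAdd, zero_add]
  ring1

theorem residue_four_three_one : residue ![4, 3, 1] = 0 := by
  rw [residue_eq]
  simp only [Matrix.cons_val, ne_eq, OfNat.ofNat_ne_zero, one_ne_zero, not_true_eq_false,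
    not_false_eq_true, and_true, and_false, and_self, false_and, if_true, if_false,
    form_four_three_one (c := ![4, 3, 1]) (by decide),
    form_four_one_three (c := move ![4, 3, 1] {0}) (by decide),
    form_four_two_two (c := move ![4, 3, 1] {1}) (by decide),
    form_five_three_zero (c := move ![4, 3, 1] {2}) (by decide),
    form_three_three_two (c := move ![4, 3, 1] {0, 1}) (by decide),
    form_four_four_zero (c := move ![4, 3, 1] {0, 2}) (by decide),
    form_five_two_one (c := move ![4, 3, 1] {1, 2}) (by decide),
    form_four_three_one (c := move ![4, 3, 1] {0, 1, 2}) (by decide)]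
  linear_combination (norm := (simp only [Nat.cast_zero, Nat.cast_one, Nat.cast_ofNat,
    Int.reduceAdd, Int.reduceSub, Int.reduceNeg, zero_add, add_zero, sub_zero]; ring1))
    Q * relation_r₂_one 1 (-1) 1 0 2 1 1
    + (Q - Z * Q ^ 2) * relation_r₁_one 1 0 1 2 1 1 2
    + (1 - Z * Q) * relation_r₂_one 2 0 1 0 1 1 1
    + Z * Q * relation_r₂_one 2 0 0 (-1) 1 1 0
    + (1 - Z * Q) * relation_r₃ 2 (-1) 0 1 1
    + relation_r₄ 1 0 0 1 0
    + relation_r₁_two 1 (-1) 1 0 1 0 2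
    + relation_r₁_one 0 0 0 0 1 1 1
    + relation_r₄ 1 (-1) 0 1 0
    + relation_r₄ 2 0 0 0 0
    + (1 - Z * Q) * relation_r₂_two 2 0 1 1 0 1 3
    - (1 - Z * Q) * relation_r₄ 2 (-1) 1 1 0
    - Q * relation_r₁_one 0 0 1 1 1 1 1
    - relation_r₃ 1 (-1) 0 0 1
    - relation_r₃ 2 0 0 0 0
    - relation_r₁_one 1 1 1 0 0 0 2
    - (Q - Z * Q ^ 2) * relation_r₂_one 2 (-1) 1 1 2 1 2
    - (1 - Z * Q) * relation_r₄ 2 0 1 1 0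
    - (1 - Z * Q) * relation_r₁_one 1 0 0 1 1 1 2
    - relation_r₂_two 1 0 1 0 0 1 2
    - (1 - Z * Q) * relation_r₁_two 2 (-1) 1 1 1 0 3

theorem residue_four_two_two : residue ![4, 2, 2] = 0 := by
  rw [residue_eq]
  simp only [Matrix.cons_val, ne_eq, OfNat.ofNat_ne_zero, one_ne_zero, not_true_eq_false,
    not_false_eq_true, and_true, and_false, and_self, false_and, if_true, if_false,
    form_four_two_two (c := ![4, 2, 2]) (by decide),
    form_three_three_two (c := move ![4, 2, 2] {0}) (by decide),
    form_four_one_three (c := move ![4, 2, 2] {1}) (by decide),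
    form_five_two_one (c := move ![4, 2, 2] {2}) (by decide),
    form_three_three_two (c := move ![4, 2, 2] {0, 1}) (by decide),
    form_four_three_one (c := move ![4, 2, 2] {0, 2}) (by decide),
    form_five_one_two (c := move ![4, 2, 2] {1, 2}) (by decide),
    form_four_two_two (c := move ![4, 2, 2] {0, 1, 2}) (by decide)]
  linear_combination (norm := (simp only [Nat.cast_zero, Nat.cast_one, Nat.cast_ofNat,
    Int.reduceAdd, Int.reduceSub, Int.reduceNeg, zero_add, add_zero, sub_zero]; ring1))
    (1 - Z * Q) * relation_r₂_one 2 (-1) 1 0 1 1 1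
    + relation_r₁_one 0 0 1 0 0 1 1
    + relation_r₂_two 1 1 1 0 (-1) 1 1
    + (1 - Z * Q) * relation_r₄ 2 0 0 0 0
    + (1 - Z * Q) * relation_r₁_one 2 1 1 0 0 1 3
    + relation_r₁_two 1 (-1) 1 0 0 1 2
    + Z * Q * relation_r₂_one 2 0 1 (-1) 0 1 0
    + (Q - Z * Q ^ 2) * relation_r₁_one 1 1 1 1 1 1 2
    - (1 - Z * Q) * relation_r₂_two 2 0 1 0 (-1) 1 1
    - relation_r₂_one 1 0 1 0 1 1 1
    - (1 - Z * Q) * relation_r₁_two 2 (-1) 1 0 1 1 3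
    - relation_r₁_one 1 1 1 0 (-1) 1 2
    - (1 - Z * Q) * relation_r₁_one 1 0 1 1 0 1 2
    - Q * relation_r₁_one 0 1 1 0 1 1 1
    - Z * Q ^ 2 * relation_r₂_one 2 1 1 (-1) 1 1 0
    - (1 - Z * Q) * relation_r₃ 2 0 0 0 0

theorem residue_four_one_three : residue ![4, 1, 3] = 0 := by
  rw [residue_eq]
  simp only [Matrix.cons_val, ne_eq, OfNat.ofNat_ne_zero, one_ne_zero, not_true_eq_false,
    not_false_eq_true, and_true, and_false, and_self, false_and, if_true, if_false,
    form_four_one_three (c := ![4, 1, 3]) (by decide),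
    form_three_three_two (c := move ![4, 1, 3] {0}) (by decide),
    form_four_four_zero (c := move ![4, 1, 3] {1}) (by decide),
    form_five_one_two (c := move ![4, 1, 3] {2}) (by decide),
    form_four_three_one (c := move ![4, 1, 3] {0, 1}) (by decide),
    form_four_two_two (c := move ![4, 1, 3] {0, 2}) (by decide),
    form_five_zero_three (c := move ![4, 1, 3] {1, 2}) (by decide),
    form_four_one_three (c := move ![4, 1, 3] {0, 1, 2}) (by decide)]
  linear_combination (norm := (simp only [Nat.cast_zero, Nat.cast_one, Nat.cast_ofNat,
    Int.reduceAdd, Int.reduceSub, Int.reduceNeg, zero_add, add_zero, sub_zero]; ring1))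
    relation_r₁_one 0 1 1 0 0 0 1
    + Z * Q ^ 2 * relation_r₁_one 2 2 1 0 (-1) 1 3
    + Z * Q * relation_r₁_one 1 1 1 1 0 0 2
    + Z * Q * relation_r₂_two 2 1 0 0 (-1) 1 1
    + Z * Q * relation_r₃ 2 1 0 0 0
    + Z * Q * relation_r₃ 2 0 0 1 0
    + Z * Q * relation_r₂_one 2 1 1 (-1) 0 0 0
    + Z * Q * relation_r₃ 2 1 0 0 (-1)
    + relation_r₃ 1 0 0 0 0
    - Z * Q * relation_r₄ 2 0 1 0 0
    - Z * Q * relation_r₂_one 2 0 0 0 1 1 1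
    - relation_r₁_one 1 1 1 0 0 1 2
    - relation_r₄ 1 0 0 0 0
    - Z * Q * relation_r₄ 2 1 0 (-1) 0
    - Z * Q * relation_r₁_two 2 0 1 0 0 1 4
    - Z * Q ^ 2 * relation_r₂_one 3 1 1 (-1) 0 1 0

theorem residue_three_three_two : residue ![3, 3, 2] = 0 := by
  rw [residue_eq]
  simp only [Matrix.cons_val, ne_eq, OfNat.ofNat_ne_zero, one_ne_zero, not_true_eq_false,
    not_false_eq_true, and_true, and_false, and_self, false_and, if_true, if_false,
    form_three_three_two (c := ![3, 3, 2]) (by decide),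
    form_four_two_two (c := move ![3, 3, 2] {0}) (by decide),
    form_three_three_two (c := move ![3, 3, 2] {1}) (by decide),
    form_four_three_one (c := move ![3, 3, 2] {2}) (by decide),
    form_three_three_two (c := move ![3, 3, 2] {0, 1}) (by decide),
    form_four_one_three (c := move ![3, 3, 2] {0, 2}) (by decide),
    form_four_two_two (c := move ![3, 3, 2] {1, 2}) (by decide),
    form_three_three_two (c := move ![3, 3, 2] {0, 1, 2}) (by decide)]
  linear_combination (norm := (simp only [Nat.cast_zero, Nat.cast_one, Nat.cast_ofNat,
    Int.reduceAdd, Int.reduceSub, Int.reduceNeg, zero_add, add_zero, sub_zero]; ring1))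
    relation_r₄ 1 (-1) 0 0 0
    + Z * Q * relation_r₂_one 2 0 0 (-1) 0 1 0
    + (Q - Z * Q ^ 2) * relation_r₃ 1 (-1) 0 2 1
    + relation_r₃ 1 0 0 0 0
    + (1 - Z * Q) * relation_r₁_one 2 1 1 0 0 0 3
    + (1 - Z * Q) * relation_r₃ 1 0 0 1 0
    + Q * relation_r₁_one 1 1 1 0 0 1 2
    -- The coefficient is `(1 - zq)(1 - zq²)`, that of the full set `J`, which fixes the profile;
    -- two of the four terms of this `R₃` form its expression at `zq³`.
    + (1 - Z * Q - Z * Q ^ 2 + Z ^ 2 * Q ^ 3) * relation_r₃ 3 0 0 0 0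
    + relation_r₃ 1 1 0 0 0
    + relation_r₁_two 1 (-1) 1 0 0 0 2
    + (Q - Z * Q ^ 2) * relation_r₁_one 1 0 1 1 0 1 2
    + relation_r₁_one 0 0 0 0 0 1 1
    + Z * Q ^ 2 * relation_r₃ 3 1 0 (-1) (-1)
    + (1 - Z * Q) * relation_r₂_two 2 0 1 0 0 1 2
    + relation_r₂_two 1 1 0 0 (-1) 1 1
    + (1 - Z * Q) * relation_r₂_one 2 (-1) 0 0 1 0 1
    - (1 - Z * Q) * relation_r₄ 2 0 0 1 0
    - relation_r₁_two 1 0 1 0 0 1 3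
    - Z * Q ^ 2 * relation_r₂_one 2 0 1 (-1) 1 1 0
    - relation_r₂_one 1 0 0 0 1 1 1
    - (1 - Z * Q) * relation_r₁_two 2 (-1) 1 0 1 0 3
    - (1 - Z * Q) * relation_r₄ 2 (-1) 0 1 0
    - relation_r₁_one 1 1 0 0 (-1) 1 2
    - (1 - Z * Q) * relation_r₂_two 2 0 0 0 (-1) 1 1
    - (Q - Z * Q ^ 2) * relation_r₂_one 2 (-1) 1 0 1 1 1
    - (1 - Z * Q) * relation_r₃ 2 0 0 0 0
    - Z * Q ^ 2 * relation_r₄ 3 1 (-1) (-1) 0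
    - (1 - Z * Q) * relation_r₁_one 1 0 0 1 0 0 2
    - Q * relation_r₁_one 0 0 1 0 1 1 1
    - relation_r₃ 1 (-1) 0 0 0
    - (1 - Z * Q) * relation_r₄ 3 0 0 0 0

theorem residue_eq_zero {c : Profile} (hc : c 0 + c 1 + c 2 = 8) : residue c = 0 := by
  obtain ⟨a, b, d, h, hs, hb, hd⟩ := normalForm_spec hc
  rw [residue, ← toSForm_coupledRelation_normalForm, h]
  change residue ![a, b, d] = 0
  have ha : a ≤ 8 := by omega
  obtain rfl : d = 8 - a - b := by omega
  interval_cases a <;> interval_cases b <;> first | omega | skip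
  · exact residue_three_three_two
  · exact residue_four_one_three
  · exact residue_four_two_two
  · exact residue_four_three_one
  · exact residue_four_four_zero
  · exact residue_five_zero_three
  · exact residue_five_one_two
  · exact residue_five_two_one
  · exact residue_five_three_zero
  · exact residue_six_zero_two
  · exact residue_six_one_one
  · exact residue_six_two_zero
  · exact residue_seven_zero_one
  · exact residue_seven_one_zero
  · exact residue_eight_zero_zero

end Mod11

end

theorem theorem4p1 :
    ∀ h ∈ Mod11.coupledSystemSForm, h ∈ Mod11.I11 6 := by
  rintro _ ⟨_, ⟨c, hc, rfl⟩, rfl⟩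
  exact Ideal.Quotient.eq_zero_iff_mem.mp (Mod11.residue_eq_zero hc)
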